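/- A right loop is a set $S$ with a binary operation $\circ$ and a two-sided identity $1$ such that every equation $X\circ a=b$ ($a,b\in S$) has a unique solution $X\in S$. For $y,z\in S$ let $f^S(y,z)$ be the permutation of $S$ sending $x$ to the unique solution $X$ of $X\circ(y\circ z)=(x\circ y)\circ z$. The group torsion $G_S$ is the subgroup of $\mathrm{Sym}(S)$ generated by all $f^S(y,z)$. A surjective homomorphism $\rho:S\to S'$ of right loops induces a surjective group homomorphism $G_S\to G_{S'}$ with $f^S(y,z)\mapsto f^{S'}(\rho(y),\rho(z))$. A congruence on $S$ is an equivalence relation on $S$ that is a right subloop of $S\times S$ (that is, a right loop under the induced operation). A congruence $\gamma$ centralizes a congruence $\beta$ if there is a congruence $C$ on the right loop $\beta$ such that, for all pairs occurring in $\beta$: (i) $(x,y)\,C\,(u,v)$ implies $x\,\gamma\,u$; (ii) for every $(x,y)\in\beta$ the map $(u,v)\mapsto u$ is a bijection from the $C$-class of $(x,y)$ onto the $\gamma$-class of $x$; (iii) $x\,\gamma\,y$ implies $(x,x)\,C\,(y,y)$; (iv) $(x,y)\,C\,(u,v)$ implies $(y,x)\,C\,(v,u)$; (v) $(x,y)\,C\,(u,v)$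 and $(y,z)\,C\,(v,w)$ imply $(x,z)\,C\,(u,w)$. A congruence is central if it is centralized by $S\times S$. There is a greatest central congruence $\zeta(S)$; the center $\mathcal Z(S)$ is its class of the identity. The center is an abelian group under $\circ$, and $S/\mathcal Z(S)=S/\zeta(S)=\{\mathcal Z(S)\circ x : x\in S\}$ is the quotient right loop. Proposition. Let $S$ be a right loop and let $\theta:G_S\to G_{S/\mathcal Z(S)}$ be the surjective homomorphism induced by the natural projection $\nu:S\to S/\mathcal Z(S)$. Then $\ker\theta$ is isomorphic to a subgroup of the direct power $\prod_{\mathcal A}\mathcal Z(S)$ of the abelian group $\mathcal Z(S)$, for some index set $\mathcal A$. If moreover $S$ is finite and $|S/\mathcal Z(S)|=k$, then $\ker\theta$ is isomorphic to a subgroup of $\mathcal Z(S)\times\cdots\times\mathcal Z(S)$ ($k-1$ factors). -/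

import Mathlib

universe u v

/-- A right loop: a binary operation with a two-sided identity such that every equation
`X * a = b` has exactly one solution `X`. -/
class RightLoop (S : Type u) extends MulOneClass S where
  existsUnique_mul_eq : ∀ a b : S, ∃! x : S, x * a = b

namespace RightLoop

section Basic

variable {S : Type u} [RightLoop S]

theorem mul_right_inj' {a x y : S} (h : x * a = y * a) : x = y :=
  (existsUnique_mul_eq a (y * a)).unique h rfl

theorem exists_mul_eq (a b : S) : ∃ x : S, x * a = b :=
  (existsUnique_mul_eq a b).exists

/-- Right multiplication `x ↦ x * a`, as a permutation of `S`. -/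
noncomputable def rightMul (a : S) : Equiv.Perm S :=
  Equiv.ofBijective (fun x => x * a) ⟨fun _ _ h => mul_right_inj' h, fun b => exists_mul_eq a b⟩

/-- The permutation `f(y, z)` of `S`: `f(y, z) x` is the unique solution `X` of
`X * (y * z) = (x * y) * z`, see `assocPerm_mul`. -/
noncomputable def assocPerm (y z : S) : Equiv.Perm S :=
  ((rightMul y).trans (rightMul z)).trans (rightMul (y * z)).symm

theorem assocPerm_mul (y z x : S) : assocPerm y z x * (y * z) = (x * y) * z :=
  (rightMul (y * z)).apply_symm_apply ((x * y) * z)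

end Basic

/-- The group torsion of `S`: the subgroup of the symmetric group on `S` generated by all the
permutations `f(y, z)`. -/
def groupTorsion (S : Type u) [RightLoop S] : Subgroup (Equiv.Perm S) :=
  Subgroup.closure {h | ∃ y z : S, h = assocPerm y z}

section Induced

variable {S : Type u} {T : Type v} [RightLoop S] [RightLoop T]

theorem map_assocPerm (ρ : S →ₙ* T) (y z x : S) :
    ρ (assocPerm y z x) = assocPerm (ρ y) (ρ z) (ρ x) := by
  apply mul_right_inj' (a := ρ y * ρ z)
  rw [assocPerm_mul, ← map_mul, ← map_mul, assocPerm_mul, map_mul, map_mul]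

theorem exists_induced (ρ : S →ₙ* T) (h : groupTorsion S) :
    ∃ k : groupTorsion T, ∀ x, (k : Equiv.Perm T) (ρ x) = ρ ((h : Equiv.Perm S) x) := by
  obtain ⟨h, hh⟩ := h
  induction hh using Subgroup.closure_induction with
  | mem g hg =>
    obtain ⟨y, z, rfl⟩ := hg
    exact ⟨⟨assocPerm (ρ y) (ρ z), Subgroup.subset_closure ⟨_, _, rfl⟩⟩,
      fun x => (map_assocPerm ρ y z x).symm⟩
  | one => exact ⟨1, fun x => rfl⟩
  | mul a b _ _ ha hb =>
    obtain ⟨k, hk⟩ := ha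
    obtain ⟨l, hl⟩ := hb
    refine ⟨k * l, fun x => ?_⟩
    have h1 := hl x
    have h2 := hk (b x)
    simp only [Subgroup.coe_mul, Equiv.Perm.mul_apply] at *
    rw [h1, h2]
  | inv a _ ha =>
    obtain ⟨k, hk⟩ := ha
    refine ⟨k⁻¹, fun x => ?_⟩
    have h1 := hk (a.symm x)
    change k.1 (ρ (a.symm x)) = ρ (a (a.symm x)) at h1
    rw [a.apply_symm_apply] at h1
    exact (Equiv.symm_apply_eq k.1).2 h1.symm

/-- The group homomorphism `G_S → G_T` induced by an onto homomorphism of right loops `ρ : S → T`: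
the image `θ h` of `h` is the permutation of `T` with `θ h (ρ x) = ρ (h x)`
(`inducedHom_apply`); it sends `f(y, z)` to `f(ρ y, ρ z)` (`inducedHom_assocPerm`). -/
noncomputable def inducedHom (ρ : S →ₙ* T) (hρ : Function.Surjective ρ) :
    groupTorsion S →* groupTorsion T :=
  MonoidHom.mk' (fun h => (exists_induced ρ h).choose) (by
    intro a b
    apply Subtype.ext
    apply Equiv.ext
    intro t
    obtain ⟨x, rfl⟩ := hρ t
    have h1 := (exists_induced ρ (a * b)).choose_spec x
    have h2 := (exists_induced ρ b).choose_spec x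
    have h3 := (exists_induced ρ a).choose_spec ((b : Equiv.Perm S) x)
    simp only [Subgroup.coe_mul, Equiv.Perm.mul_apply] at *
    rw [h1, h2, h3])

theorem inducedHom_apply (ρ : S →ₙ* T) (hρ : Function.Surjective ρ) (h : groupTorsion S) (x : S) :
    (inducedHom ρ hρ h : Equiv.Perm T) (ρ x) = ρ ((h : Equiv.Perm S) x) :=
  (exists_induced ρ h).choose_spec x

theorem inducedHom_assocPerm (ρ : S →ₙ* T) (hρ : Function.Surjective ρ) (y z : S) :
    inducedHom ρ hρ ⟨assocPerm y z, Subgroup.subset_closure ⟨y, z, rfl⟩⟩ =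
      ⟨assocPerm (ρ y) (ρ z), Subgroup.subset_closure ⟨ρ y, ρ z, rfl⟩⟩ := by
  apply Subtype.ext
  apply Equiv.ext
  intro t
  obtain ⟨x, rfl⟩ := hρ t
  rw [inducedHom_apply]
  exact map_assocPerm ρ y z x

theorem inducedHom_surjective (ρ : S →ₙ* T) (hρ : Function.Surjective ρ) :
    Function.Surjective (inducedHom ρ hρ) := by
  have h : groupTorsion T ≤ (inducedHom ρ hρ).range.map (groupTorsion T).subtype := by
    refine (Subgroup.closure_le _).2 ?_
    rintro _ ⟨y, z, rfl⟩
    obtain ⟨y, rfl⟩ := hρ y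
    obtain ⟨z, rfl⟩ := hρ z
    exact ⟨_, ⟨_, inducedHom_assocPerm ρ hρ y z⟩, rfl⟩
  intro k
  obtain ⟨k', ⟨g, hg⟩, hk⟩ := h k.2
  exact ⟨g, hg.trans (Subtype.ext hk)⟩

end Induced

/-- The direct product of two right loops. -/
instance {S : Type u} {T : Type v} [RightLoop S] [RightLoop T] : RightLoop (S × T) where
  existsUnique_mul_eq a b := by
    obtain ⟨x, hx⟩ := exists_mul_eq a.1 b.1
    obtain ⟨y, hy⟩ := exists_mul_eq a.2 b.2
    refine ⟨(x, y), Prod.ext hx hy, fun p hp => ?_⟩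
    have h1 : p.1 * a.1 = b.1 := congrArg Prod.fst hp
    have h2 : p.2 * a.2 = b.2 := congrArg Prod.snd hp
    exact Prod.ext (mul_right_inj' (h1.trans hx.symm)) (mul_right_inj' (h2.trans hy.symm))

/-- `T` is a right subloop of `S`, that is, a right loop for the induced operation. (The identity
of such a `T` is automatically that of `S`, because `e * e = e = 1 * e` forces `e = 1`, and
uniqueness of solutions is inherited from `S`.) -/
structure IsRightSubloop {S : Type u} [RightLoop S] (T : Set S) : Prop where
  one_mem : 1 ∈ T
  mul_mem : ∀ a ∈ T, ∀ b ∈ T, a * b ∈ T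
  exists_mem_mul_eq : ∀ a ∈ T, ∀ b ∈ T, ∃ x ∈ T, x * a = b

/-- The right loop structure on a right subloop. -/
abbrev IsRightSubloop.rightLoop {S : Type u} [RightLoop S] {T : Set S} (hT : IsRightSubloop T) :
    RightLoop T where
  one := ⟨1, hT.one_mem⟩
  mul a b := ⟨a.1 * b.1, hT.mul_mem _ a.2 _ b.2⟩
  one_mul a := Subtype.ext (one_mul a.1)
  mul_one a := Subtype.ext (mul_one a.1)
  existsUnique_mul_eq a b := by
    obtain ⟨x, hxT, hx⟩ := hT.exists_mem_mul_eq a.1 a.2 b.1 b.2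
    refine ⟨⟨x, hxT⟩, Subtype.ext hx, fun y hy => Subtype.ext ?_⟩
    exact mul_right_inj' ((congrArg Subtype.val hy).trans hx.symm)

/-- A congruence on `S`: an equivalence relation that is a right subloop of `S × S`. -/
structure Congruence (S : Type u) [RightLoop S] extends Setoid S where
  isRightSubloop : IsRightSubloop {p : S × S | r p.1 p.2}

namespace Congruence

/-- A congruence on `S`, regarded as a set of pairs. -/
def pairs {S : Type u} [RightLoop S] (β : Congruence S) : Set (S × S) := {p | β.r p.1 p.2}

/-- A congruence on `S`, regarded as a right loop (a right subloop of `S × S`). -/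
instance {S : Type u} [RightLoop S] (β : Congruence S) : RightLoop β.pairs :=
  β.isRightSubloop.rightLoop

/-- The congruence `S × S` on `S`. -/
def total (S : Type u) [RightLoop S] : Congruence S where
  r _ _ := True
  iseqv := ⟨fun _ => trivial, fun _ => trivial, fun _ _ => trivial⟩
  isRightSubloop := ⟨trivial, fun _ _ _ _ => trivial,
    fun a _ b _ => (exists_mul_eq a b).imp fun _ hx => ⟨trivial, hx⟩⟩

/-- `γ` centralizes `β` by means of the centering congruence `C = (γ|β)`, a congruence on the
right loop `β`. -/
structure Centralizes {S : Type u} [RightLoop S] (γ β : Congruence S) (C : Congruence β.pairs) :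
    Prop where
  fst_rel : ∀ p q : β.pairs, C.r p q → γ.r p.1.1 q.1.1
  bijOn_fst : ∀ p : β.pairs,
    Set.BijOn (fun q : β.pairs => q.1.1) {q | C.r p q} {w | γ.r p.1.1 w}
  diag : ∀ x y : S, γ.r x y → C.r ⟨(x, x), β.iseqv.refl x⟩ ⟨(y, y), β.iseqv.refl y⟩
  swap : ∀ (x y u v : S) (hxy : β.r x y) (huv : β.r u v), C.r ⟨(x, y), hxy⟩ ⟨(u, v), huv⟩ →
    C.r ⟨(y, x), β.iseqv.symm hxy⟩ ⟨(v, u), β.iseqv.symm huv⟩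
  comp : ∀ (x y z u v w : S) (hxy : β.r x y) (hyz : β.r y z) (huv : β.r u v) (hvw : β.r v w),
    C.r ⟨(x, y), hxy⟩ ⟨(u, v), huv⟩ → C.r ⟨(y, z), hyz⟩ ⟨(v, w), hvw⟩ →
      C.r ⟨(x, z), β.iseqv.trans hxy hyz⟩ ⟨(u, w), β.iseqv.trans huv hvw⟩

/-- A central congruence: one that is centralized by `S × S`. -/
def IsCentral {S : Type u} [RightLoop S] (α : Congruence S) : Prop :=
  ∃ C : Congruence α.pairs, Centralizes (total S) α C

section Lemmas

variable {S : Type u} [RightLoop S]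

theorem rel_mul (α : Congruence S) {a b c d : S} (h : α.r a b) (h' : α.r c d) :
    α.r (a * c) (b * d) :=
  α.isRightSubloop.mul_mem (a, b) h (c, d) h'

theorem rel_cancel (α : Congruence S) {x y a b : S} (h : α.r (x * a) (y * b)) (h' : α.r a b) :
    α.r x y := by
  obtain ⟨⟨p, q⟩, hp, he⟩ := α.isRightSubloop.exists_mem_mul_eq (a, b) h' (x * a, y * b) h
  have h1 : p = x := mul_right_inj' (congrArg Prod.fst he)
  have h2 : q = y := mul_right_inj' (congrArg Prod.snd he)
  subst h1 h2
  exact hp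

theorem of_rel {r : S → S → Prop} (hr : Equivalence r)
    (hm : ∀ a b c d, r a b → r c d → r (a * c) (b * d))
    (hc : ∀ x y a b, r (x * a) (y * b) → r a b → r x y) :
    IsRightSubloop {p : S × S | r p.1 p.2} where
  one_mem := hr.refl 1
  mul_mem a ha b hb := hm _ _ _ _ ha hb
  exists_mem_mul_eq a ha b hb := by
    obtain ⟨x, hx⟩ := exists_mul_eq a b
    refine ⟨x, hc x.1 x.2 a.1 a.2 ?_ ha, hx⟩
    subst hx
    exact hb

end Lemmas

/-- The quotient right loop `S / α` of congruence classes. -/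
abbrev Quo {S : Type u} [RightLoop S] (α : Congruence S) : Type u := Quotient α.toSetoid

instance {S : Type u} [RightLoop S] (α : Congruence S) : RightLoop α.Quo where
  one := Quotient.mk α.toSetoid 1
  mul := Quotient.map₂ (· * ·) fun _ _ h _ _ h' => α.rel_mul h h'
  one_mul a := Quotient.inductionOn a fun x => congrArg (Quotient.mk α.toSetoid) (one_mul x)
  mul_one a := Quotient.inductionOn a fun x => congrArg (Quotient.mk α.toSetoid) (mul_one x)
  existsUnique_mul_eq a b := by
    induction a using Quotient.inductionOn with | _ a =>
    induction b using Quotient.inductionOn with | _ b =>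
    obtain ⟨x, hx⟩ := exists_mul_eq a b
    refine ⟨Quotient.mk α.toSetoid x, congrArg (Quotient.mk α.toSetoid) hx, fun y hy => ?_⟩
    induction y using Quotient.inductionOn with | _ y =>
    have h1 : α.r (y * a) b := Quotient.exact hy
    rw [← hx] at h1
    exact Quotient.sound (s := α.toSetoid) (α.rel_cancel h1 (α.iseqv.refl a))

/-- The natural projection `S → S / α`. -/
def proj {S : Type u} [RightLoop S] (α : Congruence S) : S →ₙ* α.Quo where
  toFun := Quotient.mk α.toSetoid
  map_mul' _ _ := rfl

theorem proj_surjective {S : Type u} [RightLoop S] (α : Congruence S) :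
    Function.Surjective α.proj :=
  Quotient.mk_surjective

end Congruence

section CenterLemmas

open Congruence

variable {S : Type u} [RightLoop S]

/-- Auxiliary identities, which turn out to describe the elements of the center. -/
structure CentralElt (z : S) : Prop where
  comm : ∀ x, z * x = x * z
  assoc : ∀ x y, z * x * y = z * (x * y)
  middle : ∀ x y, x * (z * y) = z * (x * y)

theorem centralElt_of_isCentral {α : Congruence S} (hα : α.IsCentral) {z : S} (hz : α.r z 1) :
    CentralElt z := by
  obtain ⟨C, hC⟩ := hα
  -- two pairs in the same class with the same second coordinate agree
  have key : ∀ (a a' b : S) (h : α.r a b) (h' : α.r a' b),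
      C.r ⟨(z, 1), hz⟩ ⟨(a, b), h⟩ → C.r ⟨(z, 1), hz⟩ ⟨(a', b), h'⟩ → a = a' := by
    intro a a' b h h' H H'
    have i1 := hC.swap _ _ _ _ _ _ H
    have i2 := hC.swap _ _ _ _ _ _ H'
    have := (hC.bijOn_fst ⟨(1, z), α.iseqv.symm hz⟩).injOn i1 i2 rfl
    exact congrArg (fun q : α.pairs => q.1.2) this
  have hd : ∀ x, C.r ⟨(1, 1), α.iseqv.refl 1⟩ ⟨(x, x), α.iseqv.refl x⟩ :=
    fun x => hC.diag 1 x trivial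
  -- multiplying by a diagonal pair does not change the class
  have hl : ∀ (x a b : S) (h : α.r a b), C.r ⟨(z, 1), hz⟩ ⟨(a, b), h⟩ →
      C.r ⟨(z, 1), hz⟩ ⟨(x * a, x * b), α.rel_mul (α.iseqv.refl x) h⟩ := by
    intro x a b h H
    have := C.rel_mul (hd x) H
    have e : (⟨(1, 1), α.iseqv.refl 1⟩ : α.pairs) * ⟨(z, 1), hz⟩ = ⟨(z, 1), hz⟩ :=
      one_mul (⟨(z, 1), hz⟩ : α.pairs)
    rw [e] at this
    exact this
  have hr : ∀ (x a b : S) (h : α.r a b), C.r ⟨(z, 1), hz⟩ ⟨(a, b), h⟩ →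
      C.r ⟨(z, 1), hz⟩ ⟨(a * x, b * x), α.rel_mul h (α.iseqv.refl x)⟩ := by
    intro x a b h H
    have := C.rel_mul H (hd x)
    have e : (⟨(z, 1), hz⟩ : α.pairs) * ⟨(1, 1), α.iseqv.refl 1⟩ = ⟨(z, 1), hz⟩ :=
      mul_one (⟨(z, 1), hz⟩ : α.pairs)
    rw [e] at this
    exact this
  have h0 := C.iseqv.refl ⟨(z, 1), hz⟩
  have hmul : ∀ y, ∃ h : α.r (z * y) y, C.r ⟨(z, 1), hz⟩ ⟨(z * y, y), h⟩ := by
    intro y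
    have := hr y z 1 hz h0
    simp only [one_mul] at this
    exact ⟨_, this⟩
  refine ⟨fun x => ?_, fun x y => ?_, fun x y => ?_⟩
  · obtain ⟨h, H⟩ := hmul x
    have := hl x z 1 hz h0
    simp only [mul_one] at this
    exact key _ _ _ _ _ H this
  · obtain ⟨h, H⟩ := hmul x
    obtain ⟨h', H'⟩ := hmul (x * y)
    exact key _ _ _ _ _ (hr y _ _ h H) H'
  · obtain ⟨h, H⟩ := hmul y
    obtain ⟨h', H'⟩ := hmul (x * y)
    exact key _ _ _ _ _ (hl x _ _ h H) H'

namespace CentralElt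

theorem one : CentralElt (1 : S) := ⟨by simp, by simp, by simp⟩

theorem left_cancel {z : S} (hz : CentralElt z) {x y : S} (h : z * x = z * y) : x = y := by
  rw [hz.comm, hz.comm] at h
  exact mul_right_inj' h

theorem mul {z w : S} (hz : CentralElt z) (hw : CentralElt w) : CentralElt (z * w) where
  comm x := by rw [hz.assoc, hw.comm, ← hz.middle]
  assoc x y := by rw [hz.assoc, hz.assoc, hw.assoc, ← hz.assoc]
  middle x y := by rw [hz.assoc, hz.middle, hw.middle, ← hz.assoc]

theorem inv {z : S} (hz : CentralElt z) : ∃ w, CentralElt w ∧ w * z = 1 ∧ z * w = 1 := by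
  obtain ⟨w, hw⟩ := exists_mul_eq z 1
  have hw' : z * w = 1 := by rw [hz.comm, hw]
  have h1 : ∀ x, z * (w * x) = x := fun x => by rw [← hz.assoc, hw', one_mul]
  refine ⟨w, ⟨fun x => ?_, fun x y => ?_, fun x y => ?_⟩, hw, hw'⟩
  · apply hz.left_cancel
    rw [h1, ← hz.middle, hw', mul_one]
  · apply hz.left_cancel
    rw [h1, ← hz.assoc, h1]
  · apply hz.left_cancel
    rw [h1, ← hz.middle, h1]

end CentralElt

theorem centralRel_mul {z w : S} (hz : CentralElt z) (hw : CentralElt w) (x y : S) :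
    (z * x) * (w * y) = (z * w) * (x * y) := by
  rw [hz.assoc, hw.middle, ← hz.assoc]

/-- Auxiliary congruence, which turns out to be the center congruence. -/
def auxCong (S : Type u) [RightLoop S] : Congruence S :=
  have he : Equivalence fun x y : S => ∃ z, CentralElt z ∧ x = z * y := by
    refine ⟨fun x => ⟨1, .one, (one_mul x).symm⟩, ?_, ?_⟩
    · rintro x y ⟨z, hz, rfl⟩
      obtain ⟨w, hw, h1, -⟩ := hz.inv
      exact ⟨w, hw, by rw [← hw.assoc, h1, one_mul]⟩
    · rintro x y t ⟨z, hz, rfl⟩ ⟨w, hw, rfl⟩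
      exact ⟨z * w, hz.mul hw, (hz.assoc _ _).symm⟩
  { r := fun x y => ∃ z, CentralElt z ∧ x = z * y
    iseqv := he
    isRightSubloop := by
      refine of_rel he ?_ ?_
      · rintro _ b _ d ⟨z, hz, rfl⟩ ⟨w, hw, rfl⟩
        exact ⟨z * w, hz.mul hw, centralRel_mul hz hw b d⟩
      · rintro x y _ b ⟨z, hz, h⟩ ⟨w, hw, rfl⟩
        obtain ⟨w', hw', -, h1⟩ := hw.inv
        refine ⟨w' * z, hw'.mul hz, ?_⟩
        apply mul_right_inj' (a := b)
        apply hw.left_cancel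
        rw [← hw.middle, h, hw'.assoc, hw'.assoc, ← hw.assoc, h1, one_mul, hz.assoc] }

theorem auxCong_isCentral : (auxCong S).IsCentral := by
  -- the centering congruence relates pairs which differ by the same central factor
  let r : (auxCong S).pairs → (auxCong S).pairs → Prop :=
    fun p q => ∃ z, CentralElt z ∧ p.1.1 = z * p.1.2 ∧ q.1.1 = z * q.1.2
  have uniq : ∀ {z w x : S}, z * x = w * x → z = w := fun h => mul_right_inj' h
  have he : Equivalence r := by
    refine ⟨fun p => ?_, ?_, ?_⟩
    · obtain ⟨z, hz, h⟩ := p.2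
      exact ⟨z, hz, h, h⟩
    · rintro p q ⟨z, hz, h, h'⟩
      exact ⟨z, hz, h', h⟩
    · rintro p q t ⟨z, hz, h, h'⟩ ⟨w, hw, k, k'⟩
      obtain rfl : z = w := uniq (h'.symm.trans k)
      exact ⟨z, hz, h, k'⟩
  refine ⟨⟨⟨r, he⟩, of_rel he ?_ ?_⟩, ?_⟩
  · rintro a b c d ⟨z, hz, h, h'⟩ ⟨w, hw, k, k'⟩
    refine ⟨z * w, hz.mul hw, ?_, ?_⟩
    · change a.1.1 * c.1.1 = _ * (a.1.2 * c.1.2)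
      rw [h, k, centralRel_mul hz hw]
    · change b.1.1 * d.1.1 = _ * (b.1.2 * d.1.2)
      rw [h', k', centralRel_mul hz hw]
  · rintro x y a b ⟨z, hz, h, h'⟩ ⟨w, hw, k, k'⟩
    change x.1.1 * a.1.1 = z * (x.1.2 * a.1.2) at h
    change y.1.1 * b.1.1 = z * (y.1.2 * b.1.2) at h'
    obtain ⟨c, hc, e⟩ := x.2
    obtain ⟨d, hd, e'⟩ := y.2
    change x.1.1 = c * x.1.2 at e
    change y.1.1 = d * y.1.2 at e'
    rw [e, k, centralRel_mul hc hw] at h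
    rw [e', k', centralRel_mul hd hw] at h'
    obtain rfl : c = d := uniq ((uniq h).trans (uniq h').symm)
    exact ⟨c, hc, e, e'⟩
  · refine ⟨fun _ _ _ => trivial, fun p => ⟨fun _ _ => trivial, ?_, ?_⟩, ?_, ?_, ?_⟩
    · rintro q ⟨z, hz, h, h'⟩ t ⟨w, hw, k, k'⟩ hqt
      change q.1.1 = t.1.1 at hqt
      obtain rfl : z = w := uniq (h.symm.trans k)
      apply Subtype.ext
      refine Prod.ext hqt (hz.left_cancel ?_)
      rw [← h', ← k', hqt]
    · rintro x -
      obtain ⟨z, hz, h⟩ := p.2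
      obtain ⟨w, hw, -, h1⟩ := hz.inv
      have e : x = z * (w * x) := by rw [← hz.assoc, h1, one_mul]
      exact ⟨⟨(x, w * x), z, hz, e⟩, ⟨z, hz, h, e⟩, rfl⟩
    · intro x y _
      exact ⟨1, .one, (one_mul x).symm, (one_mul y).symm⟩
    · rintro x y t v hxy htv ⟨z, hz, h, h'⟩
      change x = z * y at h
      change t = z * v at h'
      obtain ⟨w, hw, h1, -⟩ := hz.inv
      refine ⟨w, hw, ?_, ?_⟩
      · change y = w * x
        rw [h, ← hw.assoc, h1, one_mul]
      · change v = w * t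
        rw [h', ← hw.assoc, h1, one_mul]
    · rintro x y c t v d hxy hyz huv hvw ⟨z, hz, h, h'⟩ ⟨w, hw, k, k'⟩
      change x = z * y at h
      change t = z * v at h'
      change y = w * c at k
      change v = w * d at k'
      refine ⟨z * w, hz.mul hw, ?_, ?_⟩
      · change x = z * w * c
        rw [h, k, hz.assoc]
      · change t = z * w * d
        rw [h', k', hz.assoc]

theorem exists_isCentral_iff (x y : S) :
    (∃ α : Congruence S, α.IsCentral ∧ α.r x y) ↔ (auxCong S).r x y := by
  refine ⟨?_, fun h => ⟨_, auxCong_isCentral, h⟩⟩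
  rintro ⟨α, hα, h⟩
  obtain ⟨z, rfl⟩ := exists_mul_eq y x
  refine ⟨z, centralElt_of_isCentral hα ?_, rfl⟩
  have h' : α.r (z * y) (1 * y) := by rwa [one_mul]
  exact α.rel_cancel h' (α.iseqv.refl y)

end CenterLemmas

/-- The center congruence `ζ(S)`: the union of all central congruences. It is the greatest central
congruence, see `centerCongruence_isCentral` and `le_centerCongruence`. -/
def centerCongruence (S : Type u) [RightLoop S] : Congruence S where
  r x y := ∃ α : Congruence S, α.IsCentral ∧ α.r x y
  iseqv := by
    simp only [exists_isCentral_iff]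
    exact (auxCong S).iseqv
  isRightSubloop := by
    simp only [exists_isCentral_iff]
    exact (auxCong S).isRightSubloop

theorem centerCongruence_isCentral (S : Type u) [RightLoop S] :
    (centerCongruence S).IsCentral := by
  have h : centerCongruence S = auxCong S := by
    have h1 : (centerCongruence S).toSetoid = (auxCong S).toSetoid :=
      Setoid.ext fun x y => exists_isCentral_iff x y
    cases hc : centerCongruence S
    cases ha : auxCong S
    rw [hc, ha] at h1
    cases h1
    rfl
  rw [h]
  exact auxCong_isCentral

theorem le_centerCongruence {S : Type u} [RightLoop S] {α : Congruence S} (hα : α.IsCentral)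
    {x y : S} (h : α.r x y) : (centerCongruence S).r x y :=
  ⟨α, hα, h⟩

/-- The center `𝒵(S)`: the class of the identity under the center congruence. -/
def center (S : Type u) [RightLoop S] : Set S := {x | (centerCongruence S).r x 1}

/-- The classes of the center congruence are the right cosets `𝒵(S) * y`. -/
theorem centerCongruence_rel_iff {S : Type u} [RightLoop S] (x y : S) :
    (centerCongruence S).r x y ↔ ∃ z ∈ center S, x = z * y := by
  constructor
  · intro h
    obtain ⟨z, rfl⟩ := exists_mul_eq y x
    refine ⟨z, (centerCongruence S).rel_cancel (a := y) (b := y) ?_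
      ((centerCongruence S).iseqv.refl y), rfl⟩
    rwa [one_mul]
  · rintro ⟨z, hz, rfl⟩
    have h := (centerCongruence S).rel_mul hz ((centerCongruence S).iseqv.refl y)
    rwa [one_mul] at h

theorem centralElt_of_mem_center {S : Type u} [RightLoop S] {z : S} (hz : z ∈ center S) :
    CentralElt z :=
  centralElt_of_isCentral (centerCongruence_isCentral S) hz

/-- The center is an abelian group for the operation of `S`. -/
noncomputable instance (S : Type u) [RightLoop S] : CommGroup (center S) where
  one := ⟨1, (centerCongruence S).iseqv.refl 1⟩
  mul a b := ⟨a.1 * b.1, by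
    have h := (centerCongruence S).rel_mul a.2 b.2
    rwa [one_mul] at h⟩
  mul_assoc a b c := Subtype.ext ((centralElt_of_mem_center a.2).assoc b.1 c.1)
  one_mul a := Subtype.ext (one_mul a.1)
  mul_one a := Subtype.ext (mul_one a.1)
  mul_comm a b := Subtype.ext ((centralElt_of_mem_center a.2).comm b.1)
  inv a := ⟨(exists_mul_eq a.1 1).choose, by
    have h := (exists_mul_eq a.1 1).choose_spec
    refine (centerCongruence S).rel_cancel (a := a.1) (b := 1) ?_ a.2
    simpa only [h, mul_one] using (centerCongruence S).iseqv.refl 1⟩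
  inv_mul_cancel a := Subtype.ext (exists_mul_eq a.1 1).choose_spec

/-- The homomorphism `θ : G_S → G_{S / 𝒵(S)}` induced by the natural projection. -/
noncomputable def theta (S : Type u) [RightLoop S] :
    groupTorsion S →* groupTorsion (centerCongruence S).Quo :=
  inducedHom (centerCongruence S).proj (centerCongruence S).proj_surjective

end RightLoop

namespace RightLoop

variable {S : Type u} [RightLoop S]

/-! Central elements can be pulled out to the left of any product, so every `assocPerm y z`, and
hence every element of the group torsion, commutes with multiplication by a central element; it also
fixes 1. An element h of ker θ preserves each class of the center congruence, and these classes are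
the cosets of the center, so h x = c(x) * x with a unique central factor c(x).

If g and h have factors c and d, then g (h x) = g (d(x) * x) = d(x) * g x = (d(x) * c(x)) * x.
Factors therefore multiply under composition, and recording them at one representative per class is
a homomorphism into a power of the center. It is injective: values at representatives determine h by
commutation with central multiplication. The identity class needs no coordinate because h 1 = 1
already fixes every central element, which leaves k - 1 coordinates. -/

theorem groupTorsion_apply_one {h : Equiv.Perm S} (hh : h ∈ groupTorsion S) : h 1 = 1 := by
  -- Point stabilizers are subgroups, so only the generators need checking.
  suffices groupTorsion S ≤ MulAction.stabilizer (Equiv.Perm S) (1 : S) from this hh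
  refine (Subgroup.closure_le _).2 ?_
  rintro _ ⟨y, z, rfl⟩
  change assocPerm y z 1 = 1
  apply mul_right_inj' (a := y * z)
  rw [assocPerm_mul, one_mul, one_mul]

/-- Associating w to the left throughout turns the equation that defines the value at w * x into w
times the one at x; right cancellation then gives the claim. -/
theorem assocPerm_centralElt_mul {w : S} (hw : CentralElt w) (y z x : S) :
    assocPerm y z (w * x) = w * assocPerm y z x := by
  apply mul_right_inj' (a := y * z)
  rw [assocPerm_mul, hw.assoc, hw.assoc, hw.assoc, assocPerm_mul]

theorem groupTorsion_apply_centralElt_mul {h : Equiv.Perm S} (hh : h ∈ groupTorsion S)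
    {w : S} (hw : CentralElt w) (x : S) : h (w * x) = w * h x := by
  induction hh using Subgroup.closure_induction generalizing x with
  | mem g hg =>
    obtain ⟨y, z, rfl⟩ := hg
    exact assocPerm_centralElt_mul hw y z x
  | one => rfl
  | mul a b _ _ ha hb => rw [Equiv.Perm.mul_apply, Equiv.Perm.mul_apply, hb, ha]
  -- The claim for the inverse at x becomes the claim for a at `a⁻¹ x`, which is why the induction
  -- generalizes x.
  | inv a _ ha => rw [Equiv.Perm.inv_eq_iff_eq, ha, ← Equiv.Perm.mul_apply a, mul_inv_cancel, Equiv.Perm.one_apply]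

/-- Acting trivially on the quotient means keeping x in its class, and that class is the coset of
the center through x. -/
theorem exists_center_mul_eq_of_mem_ker_theta (h : (theta S).ker) (x : S) :
    ∃ z : center S, (z : S) * x = (h : groupTorsion S).1 x := by
  have e := inducedHom_apply (centerCongruence S).proj (centerCongruence S).proj_surjective h.1 x
  have hk : inducedHom (centerCongruence S).proj (centerCongruence S).proj_surjective h.1 = 1 :=
    h.2
  rw [hk] at e
  have hr : (centerCongruence S).r (h.1.1 x) x :=
    (centerCongruence S).iseqv.symm (Quotient.exact e)
  obtain ⟨z, hz, hzx⟩ := (centerCongruence_rel_iff _ _).1 hr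
  exact ⟨⟨z, hz⟩, hzx.symm⟩

/-- The central factor by which an element of `ker θ` moves `x`. -/
noncomputable def centralFactor (h : (theta S).ker) (x : S) : center S :=
  (exists_center_mul_eq_of_mem_ker_theta h x).choose

theorem centralFactor_mul (h : (theta S).ker) (x : S) :
    (centralFactor h x : S) * x = (h : groupTorsion S).1 x :=
  (exists_center_mul_eq_of_mem_ker_theta h x).choose_spec

/-- An element of `ker θ` is recorded by its central factors on representatives of the
nonidentity classes of the center congruence. -/
noncomputable def kerThetaHom (S : Type u) [RightLoop S] :
    (theta S).ker →* ({q : (centerCongruence S).Quo // q ≠ 1} → center S) :=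
  MonoidHom.mk' (fun h q => centralFactor h q.1.out) (by
    intro g h
    funext q
    apply Subtype.ext
    apply mul_right_inj' (a := q.1.out)
    -- Since g moves past the factor of h, that factor comes out on the left; commutativity of the
    -- center puts the product in this order.
    rw [centralFactor_mul, Pi.mul_apply, mul_comm]
    change g.1.1 (h.1.1 q.1.out) =
      ((centralFactor h q.1.out : S) * (centralFactor g q.1.out : S)) * q.1.out
    rw [(centralElt_of_mem_center (centralFactor h q.1.out).2).assoc, centralFactor_mul,
      ← groupTorsion_apply_centralElt_mul g.1.2
        (centralElt_of_mem_center (centralFactor h q.1.out).2), centralFactor_mul])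

theorem kerThetaHom_injective : Function.Injective (kerThetaHom S) := by
  intro g h hgh
  apply Subtype.ext
  apply Subtype.ext
  apply Equiv.ext
  have hout : ∀ q : (centerCongruence S).Quo, g.1.1 q.out = h.1.1 q.out := by
    intro q
    by_cases hq : q = 1
    -- The identity class is not an index, and its chosen representative need not be 1. It is
    -- central, however, so writing it as itself times 1 shows that g and h both fix it.
    · have hz : q.out ∈ center S := Quotient.exact (q.out_eq.trans hq)
      rw [← mul_one q.out,
        groupTorsion_apply_centralElt_mul g.1.2 (centralElt_of_mem_center hz),
        groupTorsion_apply_centralElt_mul h.1.2 (centralElt_of_mem_center hz),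
        groupTorsion_apply_one g.1.2, groupTorsion_apply_one h.1.2]
    · have e : centralFactor g q.out = centralFactor h q.out := congrFun hgh ⟨q, hq⟩
      rw [← centralFactor_mul, ← centralFactor_mul, e]
  intro x
  -- Every x is a central multiple of its representative, so agreement on representatives extends to
  -- all of S.
  have hr : (centerCongruence S).r x ((centerCongruence S).proj x).out :=
    (centerCongruence S).iseqv.symm (Quotient.mk_out x)
  obtain ⟨z, hz, hx⟩ := (centerCongruence_rel_iff _ _).1 hr
  rw [hx, groupTorsion_apply_centralElt_mul g.1.2 (centralElt_of_mem_center hz),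
    groupTorsion_apply_centralElt_mul h.1.2 (centralElt_of_mem_center hz), hout]

end RightLoop

theorem mainTheorem3 {S : Type u} [RightLoop S] :
    (∃ (A : Type u) (H : Subgroup (A → RightLoop.center S)),
      Nonempty ((RightLoop.theta S).ker ≃* H)) ∧
    (Finite S → ∀ k : ℕ, Nat.card (RightLoop.centerCongruence S).Quo = k →
      ∃ H : Subgroup (Fin (k - 1) → RightLoop.center S),
        Nonempty ((RightLoop.theta S).ker ≃* H)) := by
  -- The index type is the set of nonidentity classes, and the subgroup is the range of the
  -- embedding.
  refine ⟨⟨_, _, ⟨MonoidHom.ofInjective RightLoop.kerThetaHom_injective⟩⟩, fun _ k hk => ?_⟩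
  -- The lost factor is the identity class; as that class exists, k is at least 1 and the
  -- subtraction does not truncate.
  have hcard : Nat.card {q : (RightLoop.centerCongruence S).Quo // q ≠ 1} = k - 1 := by
    classical
    have := Fintype.ofFinite (RightLoop.centerCongruence S).Quo
    rw [Nat.card_eq_fintype_card] at hk ⊢
    rw [Fintype.card_subtype_compl, Fintype.card_subtype_eq, hk]
  let e := MulEquiv.arrowCongr (Finite.equivFinOfCardEq hcard) (MulEquiv.refl (RightLoop.center S))
  have hinj : Function.Injective (e.toMonoidHom.comp (RightLoop.kerThetaHom S)) :=
    e.injective.comp RightLoop.kerThetaHom_injective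
  exact ⟨_, ⟨MonoidHom.ofInjective hinj⟩⟩
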